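/- Let $V$ be a set of laws (words in countably many letters), $\mathcal V$ the variety of groups it defines, and for a group $H$ let $V(H)\le H$ be the verbal subgroup generated by all values in $H$ of the words of $V$. For a simplicial group $K_\bullet$ let $K_\bullet/V(K_\bullet)$ be obtained by applying $H\mapsto H/V(H)$ in each degree, and let $\pi_n$ denote the $n$-th homotopy group, i.e. the $n$-th homology of the Moore complex. A free simplicial resolution of a group $G$ is a free simplicial group $K_\bullet$ (each $K_n$ is free on a basis $B_n$, and the degeneracies send $B_n$ into $B_{n+1}$) with $\pi_0(K_\bullet)\cong G$ and $\pi_m(K_\bullet)=1$ for $m\ge 1$. The Baer invariant of $G$ is $\mathcal VM(G)=\pi_1\big(K_\bullet/V(K_\bullet)\big)$. For $N\trianglelefteq G$, let $K_\bullet$, $L_\bullet$ be free simplicial resolutions of $G$, $G/N$, and let $\alpha:K_\bullet\to L_\bullet$ be an epimorphism of simplicial groups inducing the natural map $G\to G/N$ on $\pi_0$. The Baer invariant of the pair $(G,N)$ is $\mathcal VM(G,N)=\pi_1\big(\ker(\alpha/V(\alpha))\big)$, where $\alpha/V(\alpha):K_\bullet/V(K_\bullet)\to L_\bullet/V(L_\bullet)$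 is the induced map. **Theorem.** Let $G$ be the semidirect product of a normal subgroup $N$ by a subgroup $Q$, i.e. $N\cap Q=1$ and $NQ=G$. For every choice of $K_\bullet$, $L_\bullet$, $\alpha$ as above and every free simplicial resolution of $Q$ used to compute $\mathcal VM(Q)$: 1. the map $\mathcal VM(G)\to\mathcal VM(G/N)$ induced by $\alpha$ is surjective, and the map $\mathcal VM(G,N)\to\mathcal VM(G)$ induced by the inclusion of the kernel is injective with image the kernel of $\mathcal VM(G)\to\mathcal VM(G/N)$; in particular $\mathcal VM(G,N)\cong\ker\big(\mathcal VM(G)\twoheadrightarrow\mathcal VM(G/N)\big)$; 2. $\mathcal VM(G)\cong\mathcal VM(G,N)\oplus\mathcal VM(Q)$. -/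

import Mathlib

open CategoryTheory Simplicial

universe u

namespace PairBaer

/-! ### Laws and verbal subgroups -/

/-- The verbal subgroup `V(G)` of `G` for a set of laws `V`, a law being a word in countably many
letters: the subgroup generated by all values `v(g₀, g₁, …)` with `v ∈ V` and `gᵢ ∈ G`. -/
def verbal (V : Set (FreeGroup ℕ)) (G : Type*) [Group G] : Subgroup G :=
  Subgroup.closure {x | ∃ v ∈ V, ∃ g : ℕ → G, FreeGroup.lift g v = x}

theorem lift_comp_hom {G H : Type*} [Group G] [Group H] (f : G →* H) (g : ℕ → G)
    (v : FreeGroup ℕ) : f (FreeGroup.lift g v) = FreeGroup.lift (fun i => f (g i)) v := by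
  have h : f.comp (FreeGroup.lift g) = FreeGroup.lift (fun i => f (g i)) := by
    ext i
    simp
  exact DFunLike.congr_fun h v

theorem verbal_le_comap (V : Set (FreeGroup ℕ)) {G H : Type*} [Group G] [Group H] (f : G →* H) :
    verbal V G ≤ (verbal V H).comap f := by
  refine (Subgroup.closure_le _).2 ?_
  rintro _ ⟨v, hv, g, rfl⟩
  exact Subgroup.subset_closure ⟨v, hv, fun i => f (g i), (lift_comp_hom f g v).symm⟩

instance verbal_normal (V : Set (FreeGroup ℕ)) (G : Type*) [Group G] : (verbal V G).Normal :=
  ⟨fun _ hx g => verbal_le_comap V (MulAut.conj g).toMonoidHom hx⟩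

/-- The functor `τ_V : G ↦ G / V(G)`. -/
def tau (V : Set (FreeGroup ℕ)) : GrpCat.{u} ⥤ GrpCat.{u} where
  obj G := GrpCat.of (G ⧸ verbal V G)
  map f := GrpCat.ofHom (QuotientGroup.map _ _ f.hom (verbal_le_comap V f.hom))
  map_id G := by
    apply GrpCat.hom_ext
    refine QuotientGroup.monoidHom_ext _ ?_
    rfl
  map_comp f g := by
    apply GrpCat.hom_ext
    refine QuotientGroup.monoidHom_ext _ ?_
    rfl

/-! ### Simplicial groups -/

/-- Simplicial groups. -/
abbrev SGrp := SimplicialObject GrpCat.{u}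

/-- `K_. ↦ K_. / V(K_.)`, i.e. `τ_V` applied in each degree. -/
def modV (V : Set (FreeGroup ℕ)) : SGrp.{u} ⥤ SGrp.{u} :=
  (SimplicialObject.whiskering GrpCat GrpCat).obj (tau V)

/-- The kernel, taken in each degree, of a map of simplicial groups. -/
def kerS {X Y : SGrp.{u}} (f : X ⟶ Y) : SGrp.{u} where
  obj n := GrpCat.of (f.app n).hom.ker
  map {m n} θ := GrpCat.ofHom
    (((X.map θ).hom.comp (f.app m).hom.ker.subtype).codRestrict (f.app n).hom.ker (by
      rintro ⟨x, hx⟩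
      have h := ConcreteCategory.congr_hom (f.naturality θ) x
      rw [MonoidHom.mem_ker] at hx ⊢
      refine h.trans ?_
      change (Y.map θ).hom ((f.app m).hom x) = 1
      rw [hx, map_one]))
  map_id n := by
    apply GrpCat.hom_ext
    refine MonoidHom.ext fun x => Subtype.ext ?_
    exact ConcreteCategory.congr_hom (X.map_id n) x.1
  map_comp θ η := by
    apply GrpCat.hom_ext
    refine MonoidHom.ext fun x => Subtype.ext ?_
    exact ConcreteCategory.congr_hom (X.map_comp θ η) x.1

/-- The inclusion of the kernel. -/
def kerSι {X Y : SGrp.{u}} (f : X ⟶ Y) : kerS f ⟶ X where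
  app n := GrpCat.ofHom (f.app n).hom.ker.subtype
  naturality _ _ _ := rfl

/-! ### Homotopy groups, as the homology of the Moore complex -/

/-- `(NK)_n = ⋂_{i < n} ker (d_i)`. -/
def moore (K : SGrp.{u}) (n : ℕ) : Subgroup (K _⦋n⦌ : GrpCat.{u}) :=
  match n with
  | 0 => ⊤
  | n + 1 => ⨅ i : Fin (n + 1), (K.δ i.castSucc).hom.ker

/-- The cycles of the Moore complex: the kernel of `∂_n = d_n` on `(NK)_n`, and all of `K_0` in
degree `0`. -/
def cycles (K : SGrp.{u}) (n : ℕ) : Subgroup (K _⦋n⦌ : GrpCat.{u}) :=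
  match n with
  | 0 => ⊤
  | n + 1 => moore K (n + 1) ⊓ (K.δ (Fin.last (n + 1))).hom.ker

/-- The boundaries `∂_{n+1} ((NK)_{n+1})`. -/
def boundaries (K : SGrp.{u}) (n : ℕ) : Subgroup (K _⦋n⦌ : GrpCat.{u}) :=
  (moore K (n + 1)).map (K.δ (Fin.last (n + 1))).hom

instance moore_normal (K : SGrp.{u}) (n : ℕ) : (moore K n).Normal :=
  match n with
  | 0 => inferInstanceAs (⊤ : Subgroup _).Normal
  | _ + 1 => Subgroup.normal_iInf_normal fun _ => inferInstance

instance boundaries_normal (K : SGrp.{u}) (n : ℕ) : (boundaries K n).Normal := by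
  refine Subgroup.Normal.map inferInstance _ fun x => ⟨(K.σ (Fin.last n)).hom x, ?_⟩
  have h := K.δ_comp_σ_succ (i := Fin.last n)
  exact ConcreteCategory.congr_hom h x

/-- `π_n(K_.)`, the `n`-th homology group of the Moore complex. -/
abbrev homotopyGroup (K : SGrp.{u}) (n : ℕ) : Type u :=
  cycles K n ⧸ (boundaries K n).subgroupOf (cycles K n)

theorem δ_app {K L : SGrp.{u}} (f : K ⟶ L) {n : ℕ} (i : Fin (n + 2))
    (x : (K _⦋n + 1⦌ : GrpCat.{u})) :
    (L.δ i).hom ((f.app _).hom x) = (f.app _).hom ((K.δ i).hom x) :=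
  (ConcreteCategory.congr_hom (SimplicialObject.δ_naturality f i) x).symm

theorem moore_map {K L : SGrp.{u}} (f : K ⟶ L) (n : ℕ) :
    moore K n ≤ (moore L n).comap (f.app _).hom := by
  intro x hx
  cases n with
  | zero => trivial
  | succ n =>
    simp only [moore, Subgroup.mem_iInf, MonoidHom.mem_ker, Subgroup.mem_comap] at hx ⊢
    intro i
    rw [δ_app, hx i, map_one]

theorem cycles_map {K L : SGrp.{u}} (f : K ⟶ L) (n : ℕ) :
    cycles K n ≤ (cycles L n).comap (f.app _).hom := by
  intro x hx
  cases n with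
  | zero => trivial
  | succ n =>
    refine ⟨moore_map f _ hx.1, ?_⟩
    have h : (K.δ (Fin.last (n + 1))).hom x = 1 := hx.2
    change (L.δ (Fin.last (n + 1))).hom ((f.app _).hom x) = 1
    rw [δ_app, h, map_one]

theorem boundaries_map {K L : SGrp.{u}} (f : K ⟶ L) (n : ℕ) :
    boundaries K n ≤ (boundaries L n).comap (f.app _).hom := by
  rintro _ ⟨y, hy, rfl⟩
  exact ⟨(f.app _).hom y, moore_map f _ hy, δ_app f _ y⟩

/-- The homomorphism `π_n(f) : π_n(K_.) → π_n(L_.)`, `[x] ↦ [f x]`. -/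
def homotopyMap {K L : SGrp.{u}} (f : K ⟶ L) (n : ℕ) :
    homotopyGroup K n →* homotopyGroup L n :=
  QuotientGroup.map _ _
    (((f.app _).hom.comp (cycles K n).subtype).codRestrict (cycles L n)
      fun x => cycles_map f n x.2)
    fun x hx => boundaries_map f n (x := x.1) hx

/-! ### Free simplicial resolutions -/

/-- A simplicial group is free if each `K_n` is a free group on some basis `B_n ⊆ K_n`, with
`s_i(B_n) ⊆ B_{n+1}` for all degeneracies. -/
def IsFreeS (K : SGrp.{u}) : Prop :=
  ∃ B : (n : ℕ) → Set (K _⦋n⦌ : GrpCat.{u}),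
    (∀ n, Function.Bijective (FreeGroup.lift (fun b : B n => (b : (K _⦋n⦌ : GrpCat.{u}))))) ∧
    ∀ (n : ℕ) (i : Fin (n + 1)), ∀ b ∈ B n, (K.σ i).hom b ∈ B (n + 1)

/-- A free simplicial resolution of a group `G`: a free simplicial group `K_.` with an
isomorphism `π_0(K_.) ≅ G` and with `π_m(K_.)` trivial for `m ≥ 1`. -/
structure FreeResolution (G : Type u) [Group G] where
  /-- the simplicial group -/
  K : SGrp.{u}
  free : IsFreeS K
  /-- the identification of `π_0` with `G` -/
  π₀Equiv : homotopyGroup K 0 ≃* G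
  trivial_of_pos : ∀ m : ℕ, 1 ≤ m → Subsingleton (homotopyGroup K m)

/-- A resolution of a pair `(G, N)`: free simplicial resolutions `K_.` of `G` and `L_.` of `G/N`
and an epimorphism of simplicial groups `α : K_. → L_.` inducing on `π_0` the natural epimorphism
`G → G/N`. -/
structure PairResolution (G : Type u) [Group G] (N : Subgroup G) [N.Normal] where
  resG : FreeResolution G
  resQuot : FreeResolution (G ⧸ N)
  α : resG.K ⟶ resQuot.K
  α_surjective : ∀ n : ℕ, Function.Surjective (α.app (Opposite.op ⦋n⦌)).hom
  α_π₀ : ∀ x : homotopyGroup resG.K 0,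
    resQuot.π₀Equiv (homotopyMap α 0 x) = QuotientGroup.mk' N (resG.π₀Equiv x)

/-! ### Baer invariants -/

/-- The Baer invariant `𝒱M(G) = π_1(K_. / V(K_.))`, computed from a free simplicial resolution
`K_.` of `G`. -/
abbrev FreeResolution.baer {G : Type u} [Group G] (R : FreeResolution G)
    (V : Set (FreeGroup ℕ)) : Type u :=
  homotopyGroup ((modV V).obj R.K) 1

variable {G : Type u} [Group G] {N : Subgroup G} [N.Normal]

/-- The Baer invariant of the pair, `𝒱M(G, N) = π_1(ker (α / V(α)))`, computed from a resolution
of the pair. -/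
abbrev PairResolution.baer (R : PairResolution G N) (V : Set (FreeGroup ℕ)) : Type u :=
  homotopyGroup (kerS ((modV V).map R.α)) 1

/-- The map `𝒱M(G, N) → 𝒱M(G)` induced by the inclusion of the kernel. -/
def PairResolution.baerIncl (R : PairResolution G N) (V : Set (FreeGroup ℕ)) :
    R.baer V →* R.resG.baer V :=
  homotopyMap (kerSι ((modV V).map R.α)) 1

/-- The map `𝒱M(G) → 𝒱M(G/N)` induced by `α`. -/
def PairResolution.baerProj (R : PairResolution G N) (V : Set (FreeGroup ℕ)) :
    R.resG.baer V →* R.resQuot.baer V :=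
  homotopyMap ((modV V).map R.α) 1

end PairBaer

/-! A splitting `s : G/N → G` lifts to a section of `α` in degrees at most two. Each `L_n` is free,
so it suffices to find, for every simplex of `L`, a preimage with prescribed faces. Such a preimage
exists because `π_1(K)` and the higher homotopy of `L` vanish; in degree one it also exists because
the section on vertices realises `s` on `π_0`. The section respects faces but not necessarily
degeneracies, which is enough for `π_1` and `π_2` (`exists_section`).

The verbal quotient is a functor, so the section survives modulo `V` and makes `α/V` surjective on
`π_1` and `π_2`. The exact sequence `π_2(K/V) → π_2(L/V) → π_1(ker) → π_1(K/V) → π_1(L/V)` then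
breaks into a split short exact sequence (`range_homotopyMap_kerSι`, `injective_homotopyMap_kerSι`).
As `π_1` of a simplicial group is abelian, the splitting is a direct product.

Finally, `G/N ≅ Q`, and the Baer invariant does not depend on the resolution: face maps between
resolutions exist over any homomorphism, and any two over the same one are homotopic
(`nonempty_baer_mulEquiv`). -/

namespace PairBaer

/-! ### Simplicial identities on elements -/

/-- The underlying type of the group of `n`-simplices. -/
abbrev lvl (X : SGrp.{u}) (n : ℕ) : Type u := (X _⦋n⦌ : GrpCat.{u})

/-- The `i`-th face homomorphism. -/
abbrev face (X : SGrp.{u}) {n : ℕ} (i : Fin (n + 2)) : lvl X (n + 1) →* lvl X n := (X.δ i).hom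

/-- The `i`-th degeneracy homomorphism. -/
abbrev degen (X : SGrp.{u}) {n : ℕ} (i : Fin (n + 1)) : lvl X n →* lvl X (n + 1) := (X.σ i).hom

/-- The homomorphism of `n`-simplices given by a simplicial map. -/
abbrev appHom {X Y : SGrp.{u}} (f : X ⟶ Y) (n : ℕ) : lvl X n →* lvl Y n :=
  (f.app (Opposite.op ⦋n⦌)).hom

variable (X : SGrp.{u})

theorem face_face {n : ℕ} {i j : Fin (n + 2)} (h : i ≤ j) (x : lvl X (n + 2)) :
    face X i (face X j.succ x) = face X j (face X i.castSucc x) :=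
  ConcreteCategory.congr_hom (X.δ_comp_δ h) x

theorem face_degen_of_le {n : ℕ} {i : Fin (n + 2)} {j : Fin (n + 1)} (h : i ≤ j.castSucc)
    (x : lvl X (n + 1)) :
    face X i.castSucc (degen X j.succ x) = degen X j (face X i x) :=
  ConcreteCategory.congr_hom (X.δ_comp_σ_of_le h) x

theorem face_degen_of_gt {n : ℕ} {i : Fin (n + 2)} {j : Fin (n + 1)} (h : j.castSucc < i)
    (x : lvl X (n + 1)) :
    face X i.succ (degen X j.castSucc x) = degen X j (face X i x) :=
  ConcreteCategory.congr_hom (X.δ_comp_σ_of_gt h) x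

theorem face_castSucc_degen {n : ℕ} (i : Fin (n + 1)) (x : lvl X n) :
    face X i.castSucc (degen X i x) = x :=
  ConcreteCategory.congr_hom X.δ_comp_σ_self x

theorem face_succ_degen {n : ℕ} (i : Fin (n + 1)) (x : lvl X n) :
    face X i.succ (degen X i x) = x :=
  ConcreteCategory.congr_hom X.δ_comp_σ_succ x

theorem degen_app {X Y : SGrp.{u}} (f : X ⟶ Y) {n : ℕ} (i : Fin (n + 1)) (x : lvl X n) :
    degen Y i (appHom f n x) = appHom f (n + 1) (degen X i x) :=
  (ConcreteCategory.congr_hom (SimplicialObject.σ_naturality f i) x).symm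

theorem face_zero_degen_zero (x : lvl X 0) : face X 0 (degen X 0 x) = x :=
  face_castSucc_degen X 0 x
theorem face_one_degen_zero (x : lvl X 0) : face X 1 (degen X 0 x) = x :=
  face_succ_degen X 0 x

theorem face₂_zero_degen_zero (x : lvl X 1) : face X 0 (degen X 0 x) = x :=
  face_castSucc_degen X 0 x
theorem face₂_one_degen_zero (x : lvl X 1) : face X 1 (degen X 0 x) = x :=
  face_succ_degen X 0 x
theorem face₂_two_degen_zero (x : lvl X 1) :
    face X 2 (degen X 0 x) = degen X 0 (face X 1 x) :=
  face_degen_of_gt X (i := 1) (j := 0) (by decide) x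
theorem face₂_zero_degen_one (x : lvl X 1) :
    face X 0 (degen X 1 x) = degen X 0 (face X 0 x) :=
  face_degen_of_le X (i := 0) (j := 0) (by decide) x
theorem face₂_one_degen_one (x : lvl X 1) : face X 1 (degen X 1 x) = x :=
  face_castSucc_degen X 1 x
theorem face₂_two_degen_one (x : lvl X 1) : face X 2 (degen X 1 x) = x :=
  face_succ_degen X 1 x

theorem face_zero_face_one (x : lvl X 2) : face X 0 (face X 1 x) = face X 0 (face X 0 x) :=
  face_face X (i := 0) (j := 0) (by decide) x
theorem face_zero_face_two (x : lvl X 2) : face X 0 (face X 2 x) = face X 1 (face X 0 x) :=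
  face_face X (i := 0) (j := 1) (by decide) x
theorem face_one_face_two (x : lvl X 2) : face X 1 (face X 2 x) = face X 1 (face X 1 x) :=
  face_face X (i := 1) (j := 1) (by decide) x

/-! ### Moore complexes in low degrees -/

variable {X}

theorem mem_moore_succ {n : ℕ} {x : lvl X (n + 1)} :
    x ∈ moore X (n + 1) ↔ ∀ i : Fin (n + 1), face X i.castSucc x = 1 := by
  simp only [moore, Subgroup.mem_iInf, MonoidHom.mem_ker]

theorem mem_moore_one {x : lvl X 1} : x ∈ moore X 1 ↔ face X 0 x = 1 := by
  rw [mem_moore_succ, Fin.forall_fin_one]; rfl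

theorem mem_moore_two {x : lvl X 2} : x ∈ moore X 2 ↔ face X 0 x = 1 ∧ face X 1 x = 1 := by
  rw [mem_moore_succ, Fin.forall_fin_two]; rfl

theorem mem_cycles_succ {n : ℕ} {x : lvl X (n + 1)} :
    x ∈ cycles X (n + 1) ↔ ∀ i : Fin (n + 2), face X i x = 1 := by
  rw [Fin.forall_fin_succ', ← mem_moore_succ]; rfl

theorem mem_cycles_one {x : lvl X 1} : x ∈ cycles X 1 ↔ face X 0 x = 1 ∧ face X 1 x = 1 := by
  rw [mem_cycles_succ, Fin.forall_fin_two]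

theorem mem_boundaries_zero {x : lvl X 0} :
    x ∈ boundaries X 0 ↔ ∃ z : lvl X 1, face X 0 z = 1 ∧ face X 1 z = x :=
  exists_congr fun _ => and_congr_left fun _ => mem_moore_one

theorem mem_boundaries_one {x : lvl X 1} :
    x ∈ boundaries X 1 ↔ ∃ z : lvl X 2, face X 0 z = 1 ∧ face X 1 z = 1 ∧ face X 2 z = x :=
  exists_congr fun _ => (and_congr_left fun _ => mem_moore_two).trans and_assoc

theorem homotopyGroup_mk_eq_iff {n : ℕ} {x y : cycles X n} :
    (QuotientGroup.mk x : homotopyGroup X n) = QuotientGroup.mk y ↔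
      (x.1⁻¹ * y.1 : lvl X n) ∈ boundaries X n :=
  QuotientGroup.eq

theorem homotopyGroup_mk_eq_one_iff {n : ℕ} {x : cycles X n} :
    (QuotientGroup.mk x : homotopyGroup X n) = 1 ↔ (x.1 : lvl X n) ∈ boundaries X n :=
  QuotientGroup.eq_one_iff _

theorem mem_boundaries_of_subsingleton {n : ℕ} (h : Subsingleton (homotopyGroup X n))
    {x : lvl X n} (hx : x ∈ cycles X n) : x ∈ boundaries X n :=
  homotopyGroup_mk_eq_one_iff (x := ⟨x, hx⟩).1 (Subsingleton.elim _ _)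

/-- If `y` is a `2`-simplex with faces `p, a, 1` and `a` is a cycle, then `p` and `a` are
homologous. -/
theorem mul_inv_mem_boundaries_of_faces_zero_one {y : lvl X 2} {p a : lvl X 1}
    (ha : a ∈ cycles X 1) (h0 : face X 0 y = p) (h1 : face X 1 y = a) (h2 : face X 2 y = 1) :
    p * a⁻¹ ∈ boundaries X 1 := by
  rw [mem_cycles_one] at ha
  have hp0 : face X 0 p = 1 := by rw [← h0, ← face_zero_face_one, h1, ha.1]
  have hp1 : face X 1 p = 1 := by rw [← h0, ← face_zero_face_two, h2, map_one]
  -- Put `u = p a⁻¹`. The simplex `y s_0(a)⁻¹` has faces `u, 1, 1`, and `s_0(u)⁻¹ s_1(u)` has faces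
  -- `u⁻¹, 1, u`; their product carries `u` on the last face alone.
  refine mem_boundaries_one.2
    ⟨y * (degen X 0 a)⁻¹ * (degen X 0 (p * a⁻¹))⁻¹ * degen X 1 (p * a⁻¹), ?_, ?_, ?_⟩ <;>
  simp only [map_mul, map_inv, h0, h1, h2, face₂_zero_degen_zero, face₂_one_degen_zero,
    face₂_two_degen_zero, face₂_zero_degen_one, face₂_one_degen_one, face₂_two_degen_one, ha.1,
    ha.2, hp0, hp1, map_one] <;> group

/-- If `y` is a `2`-simplex with faces `1, a, b` and `a` is a cycle, then `a` and `b` are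
homologous. -/
theorem inv_mul_mem_boundaries_of_faces_one_two {y : lvl X 2} {a b : lvl X 1}
    (ha : a ∈ cycles X 1) (h0 : face X 0 y = 1) (h1 : face X 1 y = a) (h2 : face X 2 y = b) :
    a⁻¹ * b ∈ boundaries X 1 := by
  rw [mem_cycles_one] at ha
  refine mem_boundaries_one.2 ⟨(degen X 1 a)⁻¹ * y, ?_, ?_, ?_⟩ <;>
  simp only [map_mul, map_inv, h0, h1, h2, face₂_zero_degen_one, face₂_one_degen_one,
    face₂_two_degen_one, ha.1, map_one] <;> group

/-- The fundamental group of a simplicial group is commutative. -/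
theorem homotopyGroup_one_mul_comm (p q : homotopyGroup X 1) : p * q = q * p := by
  induction p using QuotientGroup.induction_on with | _ x
  induction q using QuotientGroup.induction_on with | _ y
  obtain ⟨x, hx⟩ := x
  obtain ⟨y, hy⟩ := y
  refine QuotientGroup.eq.2 (mem_boundaries_one.2 ?_ :
    (x * y)⁻¹ * (y * x) ∈ boundaries X 1)
  rw [mem_cycles_one] at hx hy
  -- For cycles, `d_0` kills the `s_1` terms, `d_2` kills the `s_0` terms, and `d_1` sends `s_0 x`
  -- and `s_1 x` both to `x`. Only `d_2` is left with a commutator.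
  refine ⟨(degen X 1 y)⁻¹ * (degen X 1 x)⁻¹ * degen X 0 x * degen X 1 y *
    (degen X 0 x)⁻¹ * degen X 1 x, ?_, ?_, ?_⟩ <;>
  simp only [map_mul, map_inv, face₂_zero_degen_zero, face₂_one_degen_zero,
    face₂_two_degen_zero, face₂_zero_degen_one, face₂_one_degen_one, face₂_two_degen_one, hx.1,
    hx.2, hy.1, map_one] <;> group

/-! ### Filling low-dimensional horns and spheres -/

theorem exists_faces_one {a b : lvl X 0} (h : a⁻¹ * b ∈ boundaries X 0) :
    ∃ y : lvl X 1, face X 0 y = a ∧ face X 1 y = b := by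
  obtain ⟨z, h0, h1⟩ := mem_boundaries_zero.1 h
  refine ⟨degen X 0 a * z, ?_, ?_⟩
  · rw [map_mul, h0, face_zero_degen_zero, mul_one]
  · rw [map_mul, h1, face_one_degen_zero, mul_inv_cancel_left]

/-- A case of the Kan condition, valid in every simplicial group: `s_0(a)` has the right zeroth
face, and the `s_1` factor repairs the second without disturbing it. -/
theorem exists_faces_zero_two {a c : lvl X 1} (h : face X 1 a = face X 0 c) :
    ∃ y : lvl X 2, face X 0 y = a ∧ face X 2 y = c := by
  refine ⟨degen X 0 a * degen X (n := 1) 1 ((degen X 0 (face X 1 a))⁻¹ * c), ?_, ?_⟩ <;>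
  simp only [map_mul, map_inv, face₂_zero_degen_zero, face₂_two_degen_zero,
    face₂_zero_degen_one, face₂_two_degen_one, face_zero_degen_zero, h] <;> group

/-- Fill the horn formed by `a` and `b`. The error on the remaining face is a cycle, hence the last
face of a Moore `2`-simplex, by which the filler can be corrected. -/
theorem exists_faces_two (hX : Subsingleton (homotopyGroup X 1)) {a b c : lvl X 1}
    (hab : face X 0 b = face X 0 a) (hac : face X 0 c = face X 1 a)
    (hbc : face X 1 c = face X 1 b) :
    ∃ y : lvl X 2, face X 0 y = a ∧ face X 1 y = b ∧ face X 2 y = c := by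
  obtain ⟨w, hw0, hw1⟩ : ∃ w : lvl X 2, face X 0 w = a ∧ face X 1 w = b := by
    refine ⟨degen X 0 a * degen X 1 (a⁻¹ * b), ?_, ?_⟩ <;>
    simp only [map_mul, map_inv, face₂_zero_degen_zero, face₂_one_degen_zero,
      face₂_zero_degen_one, face₂_one_degen_one, hab] <;> group
  have hc : (face X 2 w)⁻¹ * c ∈ boundaries X 1 := by
    refine mem_boundaries_of_subsingleton hX (mem_cycles_one.2 ⟨?_, ?_⟩)
    · rw [map_mul, map_inv, face_zero_face_two, hw0, hac, inv_mul_cancel]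
    · rw [map_mul, map_inv, face_one_face_two, hw1, hbc, inv_mul_cancel]
  obtain ⟨z, hz0, hz1, hz2⟩ := mem_boundaries_one.1 hc
  exact ⟨w * z, by rw [map_mul, hw0, hz0, mul_one], by rw [map_mul, hw1, hz1, mul_one],
    by rw [map_mul, hz2, mul_inv_cancel_left]⟩

/-! ### Degreewise surjective maps -/

section Surjective

variable {Y : SGrp.{u}} (f : X ⟶ Y)

/-- Starting from any preimage `y`, the faces before the last are killed in increasing order. -/
theorem exists_mem_moore_lift (hf : ∀ n, Function.Surjective (appHom f n)) {n : ℕ} {w : lvl Y n}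
    (hw : w ∈ moore Y n) : ∃ y ∈ moore X n, appHom f n y = w := by
  cases n with
  | zero =>
    obtain ⟨y, hy⟩ := hf 0 w
    exact ⟨y, trivial, hy⟩
  | succ n =>
    rw [mem_moore_succ] at hw
    have key : ∀ k ≤ n + 1, ∃ y : lvl X (n + 1),
        (∀ i : Fin (n + 1), (i : ℕ) < k → face X i.castSucc y = 1) ∧ appHom f (n + 1) y = w := by
      intro k
      induction k with
      | zero =>
        obtain ⟨y, hy⟩ := hf (n + 1) w
        exact fun _ => ⟨y, fun i hi => absurd hi (Nat.not_lt_zero _), hy⟩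
      | succ k ih =>
        intro hk
        obtain ⟨y, hy, hyw⟩ := ih (Nat.le_of_succ_le hk)
        let j : Fin (n + 1) := ⟨k, hk⟩
        -- The factor cancels `d_k y`. For `i < k`, `d_i s_k d_k y = s_{k-1} d_{k-1} d_i y = 1`, so
        -- earlier faces stay trivial; the image stays `w` because `d_k w = 1`.
        refine ⟨y * (degen X j (face X j.castSucc y))⁻¹, fun i hi => ?_, ?_⟩
        · rcases Nat.lt_succ_iff_lt_or_eq.1 hi with hik | hik
          · cases n with
            | zero => omega
            | succ m =>
              obtain ⟨j', hj'⟩ : ∃ j' : Fin (m + 1), j'.succ = j :=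
                Fin.exists_succ_eq.2 (fun h0 => by
                  have : k = 0 := congrArg Fin.val h0
                  omega)
              obtain ⟨i', hi'⟩ : ∃ i' : Fin (m + 1), i'.castSucc = i :=
                Fin.exists_castSucc_eq.2 (fun h0 => by
                  have h2 : (i : ℕ) = m + 1 := congrArg Fin.val h0
                  omega)
              have hle : i'.castSucc ≤ j'.castSucc := by
                rw [Fin.le_def]
                have h1 : (j' : ℕ) + 1 = k := congrArg Fin.val hj'
                have h2 : (i' : ℕ) = i := congrArg Fin.val hi'
                simp only [Fin.val_castSucc]
                omega
              have e1 : face X i.castSucc (degen X j (face X j.castSucc y)) =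
                  degen X j' (face X i'.castSucc (face X j.castSucc y)) := by
                rw [← hj', ← hi']
                exact face_degen_of_le X hle _
              have e2 : face X i'.castSucc (face X j.castSucc y) = 1 := by
                have := face_face X (i := i'.castSucc) (j := j'.castSucc) hle y
                rw [hi', hy i hik, map_one] at this
                rw [← hj']
                exact hi' ▸ this
              rw [map_mul, map_inv, hy i hik, e1, e2, map_one, inv_one, mul_one]
          · obtain rfl : i = j := Fin.ext hik
            rw [map_mul, map_inv, face_castSucc_degen, mul_inv_cancel]
        · rw [map_mul, map_inv, hyw, ← degen_app, ← δ_app, hyw, hw, map_one, inv_one, mul_one]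
    obtain ⟨y, hy, hyw⟩ := key (n + 1) le_rfl
    exact ⟨y, mem_moore_succ.2 fun i => hy i i.2, hyw⟩

/-! ### Degreewise kernels and exactness on homotopy groups. -/

theorem mem_moore_kerS {n : ℕ} {x : lvl (kerS f) n} :
    x ∈ moore (kerS f) n ↔ (x.1 : lvl X n) ∈ moore X n := by
  cases n with
  | zero => exact ⟨fun _ => trivial, fun _ => trivial⟩
  | succ n =>
    rw [mem_moore_succ, mem_moore_succ]
    exact forall_congr' fun i => ⟨fun h => congrArg Subtype.val h, fun h => Subtype.ext h⟩

theorem mem_cycles_kerS {n : ℕ} {x : lvl (kerS f) (n + 1)} :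
    x ∈ cycles (kerS f) (n + 1) ↔ (x.1 : lvl X (n + 1)) ∈ cycles X (n + 1) := by
  rw [mem_cycles_succ, mem_cycles_succ]
  exact forall_congr' fun i => ⟨fun h => congrArg Subtype.val h, fun h => Subtype.ext h⟩

theorem homotopyMap_mk {n : ℕ} (x : cycles X n) :
    homotopyMap f n (QuotientGroup.mk x) =
      QuotientGroup.mk ⟨appHom f n x.1, cycles_map f n x.2⟩ := rfl

theorem homotopyMap_eq_one_iff {n : ℕ} (x : cycles X n) :
    homotopyMap f n (QuotientGroup.mk x) = 1 ↔ appHom f n x.1 ∈ boundaries Y n :=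
  QuotientGroup.eq_one_iff _

/-- Exactness of `π_n(ker f) → π_n(X) → π_n(Y)` for `n ≥ 1`. -/
theorem range_homotopyMap_kerSι (hf : ∀ n, Function.Surjective (appHom f n)) (n : ℕ) :
    (homotopyMap (kerSι f) (n + 1)).range = (homotopyMap f (n + 1)).ker := by
  ext p
  constructor
  · rintro ⟨q, rfl⟩
    induction q using QuotientGroup.induction_on with | _ x
    rw [MonoidHom.mem_ker, homotopyMap_mk, homotopyMap_eq_one_iff]
    have : appHom f (n + 1) (appHom (kerSι f) (n + 1) x.1) = 1 := x.1.2
    change appHom f (n + 1) (appHom (kerSι f) (n + 1) x.1) ∈ _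
    rw [this]
    exact one_mem _
  · induction p using QuotientGroup.induction_on with | _ x
    obtain ⟨x, hx⟩ := x
    rw [MonoidHom.mem_ker, homotopyMap_eq_one_iff]
    rintro ⟨w, hw, hwx⟩
    obtain ⟨v, hv, rfl⟩ := exists_mem_moore_lift f hf hw
    have hb : face X (Fin.last (n + 2)) v ∈ boundaries X (n + 1) := ⟨v, hv, rfl⟩
    have hbc : face X (Fin.last (n + 2)) v ∈ cycles X (n + 1) := by
      rw [mem_cycles_succ]
      intro i
      have h := face_face X (Fin.le_last i) v
      rw [mem_moore_succ.1 hv i, map_one] at h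
      exact h
    -- Dividing by the boundary of `v`, whose image is `f x`, moves `x` into the kernel without
    -- changing its class.
    let k : lvl (kerS f) (n + 1) := ⟨x * (face X (Fin.last (n + 2)) v)⁻¹, by
      change appHom f (n + 1) _ = 1
      rw [map_mul, map_inv, ← δ_app, mul_inv_eq_one]
      exact hwx.symm⟩
    refine ⟨QuotientGroup.mk ⟨k, (mem_cycles_kerS f).2 (mul_mem hx (inv_mem hbc))⟩, ?_⟩
    rw [homotopyMap_mk]
    refine homotopyGroup_mk_eq_iff.2 ?_
    change (x * (face X (Fin.last (n + 2)) v)⁻¹)⁻¹ * x ∈ _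
    simpa using hb

/-- If `π_{n+1}(f)` is surjective, then `π_n(ker f) → π_n(X)` is injective, for `n ≥ 1`. -/
theorem injective_homotopyMap_kerSι (hf : ∀ n, Function.Surjective (appHom f n)) {n : ℕ}
    (h : Function.Surjective (homotopyMap f (n + 2))) :
    Function.Injective (homotopyMap (kerSι f) (n + 1)) := by
  rw [injective_iff_map_eq_one]
  intro q hq
  induction q using QuotientGroup.induction_on with | _ x
  obtain ⟨x, hx⟩ := x
  rw [homotopyMap_eq_one_iff] at hq
  obtain ⟨y, hy, hyx⟩ := hq
  have hc : appHom f (n + 2) y ∈ cycles Y (n + 2) := by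
    refine ⟨moore_map f _ hy, ?_⟩
    change face Y (Fin.last (n + 2)) (appHom f (n + 2) y) = 1
    rw [δ_app, hyx]
    exact x.2
  obtain ⟨p, hp⟩ := h (QuotientGroup.mk ⟨_, hc⟩)
  induction p using QuotientGroup.induction_on with | _ z
  obtain ⟨z, hz⟩ := z
  obtain ⟨w, hw, hwz⟩ : (appHom f (n + 2) z)⁻¹ * appHom f (n + 2) y ∈ boundaries Y (n + 2) :=
    homotopyGroup_mk_eq_iff.1 hp
  obtain ⟨v, hv, rfl⟩ := exists_mem_moore_lift f hf hw
  have hv' : ∀ i, face X i (face X (Fin.last (n + 3)) v) = 1 := by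
    intro i
    have h := face_face X (Fin.le_last i) v
    rw [mem_moore_succ.1 hv i, map_one] at h
    exact h
  have hz' := mem_cycles_succ.1 hz
  -- Here `y` bounds `x` in `X`. The correction has the same image as `y` and all faces trivial, so
  -- the quotient still bounds `x` but lies in the kernel.
  let k : lvl (kerS f) (n + 2) := ⟨y * (z * face X (Fin.last (n + 3)) v)⁻¹, by
    change appHom f (n + 2) _ = 1
    change face Y (Fin.last (n + 3)) _ = _ at hwz
    rw [δ_app] at hwz
    rw [map_mul, map_inv, map_mul, hwz, mul_inv_cancel_left, mul_inv_cancel]⟩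
  refine (QuotientGroup.eq_one_iff _).2 ⟨k, (mem_moore_kerS f).2 ?_, Subtype.ext ?_⟩
  · have hy := mem_moore_succ.1 hy
    refine mem_moore_succ.2 fun i => ?_
    change face X _ (_ * _) = 1
    rw [map_mul, map_inv, map_mul, hy, hz', hv']
    simp
  · change face X _ (_ * _) = x.1
    change face X _ y = x.1 at hyx
    rw [map_mul, map_inv, map_mul, hyx, hz', hv']
    simp

/-- A map of simplicial groups with a section in degrees `n` and `n + 1` compatible with the
faces is surjective on `π_{n+1}`. -/
theorem surjective_homotopyMap_of_section {n : ℕ} (b : lvl Y n →* lvl X n)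
    (b' : lvl Y (n + 1) →* lvl X (n + 1)) (hb : ∀ i x, face X i (b' x) = b (face Y i x))
    (hs : ∀ x, appHom f (n + 1) (b' x) = x) :
    Function.Surjective (homotopyMap f (n + 1)) := by
  intro p
  induction p using QuotientGroup.induction_on with | _ x
  obtain ⟨x, hx⟩ := x
  refine ⟨QuotientGroup.mk ⟨b' x, ?_⟩, ?_⟩
  · rw [mem_cycles_succ] at hx ⊢
    intro i
    rw [hb, hx, map_one]
  · rw [homotopyMap_mk]
    exact congrArg _ (Subtype.ext (hs x))

end Surjective

end PairBaer

namespace PairBaer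

/-! ### Reduction modulo the verbal subgroup of homomorphisms between simplices -/

section ModV

variable (V : Set (FreeGroup ℕ)) {X Y : SGrp.{u}}

/-- The projection of the `n`-simplices of `X` onto those of `X / V(X)`. -/
def toModV (X : SGrp.{u}) (n : ℕ) : lvl X n →* lvl ((modV V).obj X) n :=
  QuotientGroup.mk' (verbal V (lvl X n))

theorem toModV_surjective (X : SGrp.{u}) (n : ℕ) : Function.Surjective (toModV V X n) :=
  QuotientGroup.mk'_surjective _

theorem face_toModV {n : ℕ} (i : Fin (n + 2)) (x : lvl X (n + 1)) :
    face ((modV V).obj X) i (toModV V X (n + 1) x) = toModV V X n (face X i x) := rfl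

/-- The homomorphism modulo verbal subgroups induced by a homomorphism between simplices. -/
def levelMap {m n : ℕ} (g : lvl X m →* lvl Y n) :
    lvl ((modV V).obj X) m →* lvl ((modV V).obj Y) n :=
  QuotientGroup.map _ _ g (verbal_le_comap V g)

theorem levelMap_toModV {m n : ℕ} (g : lvl X m →* lvl Y n) (x : lvl X m) :
    levelMap V g (toModV V X m x) = toModV V Y n (g x) := rfl

/-- Sections and homotopies are built from separate homomorphisms, not simplicial maps; their face
identities descend by functoriality of the verbal quotient. -/
theorem face_levelMap {m n : ℕ} {g : lvl X m →* lvl Y (n + 1)} {g' : lvl X m →* lvl Y n}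
    {i : Fin (n + 2)} (h : ∀ x, face Y i (g x) = g' x) (x : lvl ((modV V).obj X) m) :
    face ((modV V).obj Y) i (levelMap V g x) = levelMap V g' x := by
  obtain ⟨x, rfl⟩ := toModV_surjective V X m x
  rw [levelMap_toModV, levelMap_toModV, face_toModV, h]

theorem levelMap_comp_face {m n : ℕ} (g : lvl X m →* lvl Y n) (i : Fin (m + 2))
    (x : lvl ((modV V).obj X) (m + 1)) :
    levelMap V (g.comp (face X i)) x = levelMap V g (face ((modV V).obj X) i x) := by
  obtain ⟨x, rfl⟩ := toModV_surjective V X (m + 1) x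
  rfl

theorem face_levelMap_comp_face {m n : ℕ} {g : lvl X (m + 1) →* lvl Y (n + 1)}
    {g' : lvl X m →* lvl Y n} {i : Fin (n + 2)} {j : Fin (m + 2)}
    (h : ∀ x, face Y i (g x) = g' (face X j x)) (x : lvl ((modV V).obj X) (m + 1)) :
    face ((modV V).obj Y) i (levelMap V g x) =
      levelMap V g' (face ((modV V).obj X) j x) := by
  rw [face_levelMap V (g' := g'.comp (face X j)) h, levelMap_comp_face]

theorem appHom_modV_surjective {f : X ⟶ Y} {n : ℕ} (hf : Function.Surjective (appHom f n)) :
    Function.Surjective (appHom ((modV V).map f) n) := by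
  intro y
  obtain ⟨y, rfl⟩ := toModV_surjective V Y n y
  obtain ⟨x, rfl⟩ := hf y
  exact ⟨toModV V X n x, rfl⟩

end ModV

/-! ### Maps compatible with the faces in degrees at most two -/

/-- Homomorphisms between the simplices of dimension at most `2` that are compatible with the
faces, but not necessarily with the degeneracies. -/
structure FaceMap (X Y : SGrp.{u}) where
  /-- the map on vertices -/
  h₀ : lvl X 0 →* lvl Y 0
  /-- the map on `1`-simplices -/
  h₁ : lvl X 1 →* lvl Y 1
  /-- the map on `2`-simplices -/
  h₂ : lvl X 2 →* lvl Y 2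
  face_h₁ : ∀ i x, face Y i (h₁ x) = h₀ (face X i x)
  face_h₂ : ∀ i x, face Y i (h₂ x) = h₁ (face X i x)

namespace FaceMap

variable {X Y Z : SGrp.{u}}

/-- The identity. -/
protected def id (X : SGrp.{u}) : FaceMap X X where
  h₀ := .id _
  h₁ := .id _
  h₂ := .id _
  face_h₁ _ _ := rfl
  face_h₂ _ _ := rfl

/-- Composition. -/
def comp (F : FaceMap Y Z) (E : FaceMap X Y) : FaceMap X Z where
  h₀ := F.h₀.comp E.h₀
  h₁ := F.h₁.comp E.h₁
  h₂ := F.h₂.comp E.h₂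
  face_h₁ i x := (F.face_h₁ i _).trans (congrArg F.h₀ (E.face_h₁ i x))
  face_h₂ i x := (F.face_h₂ i _).trans (congrArg F.h₁ (E.face_h₂ i x))

/-- The face map modulo verbal subgroups. -/
def modV (F : FaceMap X Y) (V : Set (FreeGroup ℕ)) :
    FaceMap ((PairBaer.modV V).obj X) ((PairBaer.modV V).obj Y) where
  h₀ := levelMap V F.h₀
  h₁ := levelMap V F.h₁
  h₂ := levelMap V F.h₂
  face_h₁ i := face_levelMap_comp_face V (F.face_h₁ i)
  face_h₂ i := face_levelMap_comp_face V (F.face_h₂ i)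

theorem h₁_mem_cycles (F : FaceMap X Y) {x : lvl X 1} (hx : x ∈ cycles X 1) :
    F.h₁ x ∈ cycles Y 1 := by
  rw [mem_cycles_succ] at hx ⊢
  intro i
  rw [F.face_h₁, hx, map_one]

theorem h₁_mem_boundaries (F : FaceMap X Y) {x : lvl X 1} (hx : x ∈ boundaries X 1) :
    F.h₁ x ∈ boundaries Y 1 := by
  obtain ⟨z, h0, h1, h2⟩ := mem_boundaries_one.1 hx
  refine mem_boundaries_one.2 ⟨F.h₂ z, ?_, ?_, ?_⟩
  · rw [F.face_h₂, h0, map_one]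
  · rw [F.face_h₂, h1, map_one]
  · rw [F.face_h₂, h2]

/-- The homomorphism induced on fundamental groups. -/
def π₁ (F : FaceMap X Y) : homotopyGroup X 1 →* homotopyGroup Y 1 :=
  QuotientGroup.map _ _
    ((F.h₁.comp (cycles X 1).subtype).codRestrict (cycles Y 1) fun x => F.h₁_mem_cycles x.2)
    fun x hx => F.h₁_mem_boundaries (x := x.1) hx

theorem π₁_mk (F : FaceMap X Y) (x : cycles X 1) :
    F.π₁ (QuotientGroup.mk x) = QuotientGroup.mk ⟨F.h₁ x.1, F.h₁_mem_cycles x.2⟩ := rfl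

theorem π₁_comp_modV (F : FaceMap Y Z) (E : FaceMap X Y) (V : Set (FreeGroup ℕ))
    (p : homotopyGroup ((PairBaer.modV V).obj X) 1) :
    ((F.comp E).modV V).π₁ p = (F.modV V).π₁ ((E.modV V).π₁ p) := by
  induction p using QuotientGroup.induction_on with | _ x
  obtain ⟨x, hx⟩ := x
  simp only [π₁_mk]
  obtain ⟨y, rfl⟩ := toModV_surjective V X 1 x
  rfl

theorem π₁_id_modV (V : Set (FreeGroup ℕ)) (p : homotopyGroup ((PairBaer.modV V).obj X) 1) :
    ((FaceMap.id X).modV V).π₁ p = p := by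
  induction p using QuotientGroup.induction_on with | _ x
  obtain ⟨x, hx⟩ := x
  simp only [π₁_mk]
  obtain ⟨y, rfl⟩ := toModV_surjective V X 1 x
  rfl

/-- Face maps related by a homotopy, given by `h`, `a` and `b` on simplices of dimension at most
one, induce the same map on fundamental groups modulo verbal subgroups. -/
theorem π₁_modV_eq_of_homotopy (V : Set (FreeGroup ℕ)) (F E : FaceMap X Y)
    (h : lvl X 0 →* lvl Y 1) (a b : lvl X 1 →* lvl Y 2)
    (ha0 : ∀ x, face Y 0 (a x) = F.h₁ x) (ha2 : ∀ x, face Y 2 (a x) = h (face X 1 x))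
    (hb0 : ∀ x, face Y 0 (b x) = h (face X 0 x)) (hb1 : ∀ x, face Y 1 (b x) = face Y 1 (a x))
    (hb2 : ∀ x, face Y 2 (b x) = E.h₁ x) :
    (F.modV V).π₁ = (E.modV V).π₁ := by
  refine MonoidHom.ext fun p => ?_
  induction p using QuotientGroup.induction_on with | _ x
  obtain ⟨x, hx⟩ := x
  have hx' := mem_cycles_one.1 hx
  rw [π₁_mk, π₁_mk, homotopyGroup_mk_eq_iff]
  change (levelMap V F.h₁ x)⁻¹ * levelMap V E.h₁ x ∈ _
  -- The prism over the edge `x` is two triangles `a x` and `b x` glued along a diagonal, their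
  -- common face `1`. Since `x` is a cycle only modulo `V`, all identities are first reduced; the
  -- sides given by `h` then become trivial, and both ends are homologous to the diagonal.
  have A0 := face_levelMap V ha0 x
  have A2 := face_levelMap_comp_face V ha2 x
  have B0 := face_levelMap_comp_face V hb0 x
  have A1 := face_levelMap V (g' := (face Y 1).comp a) (fun _ => rfl) x
  have B1 := face_levelMap V (g' := (face Y 1).comp a) hb1 x
  have B2 := face_levelMap V hb2 x
  rw [hx'.2, map_one] at A2
  rw [hx'.1, map_one] at B0
  have hE : levelMap V E.h₁ x ∈ cycles _ 1 := (E.modV V).h₁_mem_cycles hx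
  rw [mem_cycles_one] at hE
  have hc : levelMap V ((face Y 1).comp a) x ∈ cycles ((PairBaer.modV V).obj Y) 1 := by
    refine mem_cycles_one.2 ⟨?_, ?_⟩
    · rw [← B1, face_zero_face_one, B0, map_one]
    · rw [← B1, ← face_one_face_two, B2, hE.2]
  have h1 := mul_inv_mem_boundaries_of_faces_zero_one hc A0 A1 A2
  have h2 := inv_mul_mem_boundaries_of_faces_one_two hc B0 B1 B2
  have h3 := inv_mem h1
  rw [mul_inv_rev, inv_inv] at h3
  have h4 := mul_mem ((boundaries_normal ((PairBaer.modV V).obj Y) 1).mem_comm h3) h2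
  rwa [mul_assoc, mul_inv_cancel_left] at h4

end FaceMap

/-! ### Free simplicial resolutions -/

/-- Homomorphisms from the simplices of a free simplicial group lift along homomorphisms whose
range contains theirs. -/
theorem IsFreeS.exists_lift {X : SGrp.{u}} (hX : IsFreeS X) (n : ℕ) {H T : Type*} [Group H]
    [Group T] (p : H →* T) (q : lvl X n →* T) (h : ∀ x, ∃ y, p y = q x) :
    ∃ r : lvl X n →* H, ∀ x, p (r x) = q x := by
  obtain ⟨B, hB, -⟩ := hX
  let e : FreeGroup (B n) ≃* lvl X n := MulEquiv.ofBijective _ (hB n)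
  choose c hc using h
  let r : FreeGroup (B n) →* H := FreeGroup.lift fun b => c b
  have hr : p.comp r = q.comp e.toMonoidHom := by
    ext b
    simp [r, e, hc]
  refine ⟨r.comp e.symm.toMonoidHom, fun x => ?_⟩
  have := DFunLike.congr_fun hr (e.symm x)
  simpa using this

namespace FreeResolution

variable {G : Type u} [Group G] (R : FreeResolution G)

/-- The augmentation `K_0 → G`. -/
def ε : lvl R.K 0 →* G :=
  R.π₀Equiv.toMonoidHom.comp ((QuotientGroup.mk' _).comp
    ((MonoidHom.id (lvl R.K 0)).codRestrict (cycles R.K 0) fun _ => trivial))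

theorem ε_apply (x : lvl R.K 0) : R.ε x = R.π₀Equiv (QuotientGroup.mk ⟨x, trivial⟩) := rfl

theorem ε_surjective : Function.Surjective R.ε := by
  intro g
  obtain ⟨p, rfl⟩ := R.π₀Equiv.surjective g
  induction p using QuotientGroup.induction_on with | _ x
  exact ⟨x.1, rfl⟩

theorem ε_eq_iff {x y : lvl R.K 0} : R.ε x = R.ε y ↔ x⁻¹ * y ∈ boundaries R.K 0 := by
  rw [ε_apply, ε_apply, R.π₀Equiv.injective.eq_iff, homotopyGroup_mk_eq_iff]

theorem ε_face (y : lvl R.K 1) : R.ε (face R.K 0 y) = R.ε (face R.K 1 y) := by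
  rw [ε_eq_iff, mem_boundaries_zero]
  refine ⟨(degen R.K 0 (face R.K 0 y))⁻¹ * y, ?_, ?_⟩
  · rw [map_mul, map_inv, face_zero_degen_zero, inv_mul_cancel]
  · rw [map_mul, map_inv, face_one_degen_zero]

variable {G' : Type u} [Group G'] (S : FreeResolution G')

/-- In each degree a simplex of `S.K` with the required faces exists by `ε_eq_iff` or acyclicity;
freeness turns these pointwise choices into a homomorphism. -/
theorem exists_faceMap (φ : G →* G') :
    ∃ F : FaceMap R.K S.K, ∀ x, S.ε (F.h₀ x) = φ (R.ε x) := by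
  obtain ⟨h₀, hh₀⟩ := R.free.exists_lift 0 S.ε (φ.comp R.ε) fun x => S.ε_surjective _
  obtain ⟨h₁, hh₁⟩ := R.free.exists_lift 1 ((face S.K 0).prod (face S.K 1))
    ((h₀.comp (face R.K 0)).prod (h₀.comp (face R.K 1))) fun x => by
      have h : S.ε (h₀ (face R.K 0 x)) = S.ε (h₀ (face R.K 1 x)) := by
        rw [hh₀, hh₀]
        exact congrArg φ (R.ε_face x)
      obtain ⟨y, h0, h1⟩ := exists_faces_one (S.ε_eq_iff.1 h)
      exact ⟨y, Prod.ext h0 h1⟩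
  have hf₁ : ∀ i x, face S.K i (h₁ x) = h₀ (face R.K i x) :=
    Fin.forall_fin_two.2
      ⟨fun x => congrArg Prod.fst (hh₁ x), fun x => congrArg Prod.snd (hh₁ x)⟩
  obtain ⟨h₂, hh₂⟩ := R.free.exists_lift 2 ((face S.K 0).prod ((face S.K 1).prod (face S.K 2)))
    ((h₁.comp (face R.K 0)).prod ((h₁.comp (face R.K 1)).prod (h₁.comp (face R.K 2))))
    fun x => by
      obtain ⟨y, h0, h1, h2⟩ := exists_faces_two (S.trivial_of_pos 1 le_rfl)
        (a := h₁ (face R.K 0 x)) (b := h₁ (face R.K 1 x)) (c := h₁ (face R.K 2 x))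
        (by rw [hf₁, hf₁, face_zero_face_one]) (by rw [hf₁, hf₁, face_zero_face_two])
        (by rw [hf₁, hf₁, face_one_face_two])
      exact ⟨y, Prod.ext h0 (Prod.ext h1 h2)⟩
  refine ⟨⟨h₀, h₁, h₂, hf₁, ?_⟩, hh₀⟩
  rw [Fin.forall_fin_succ, Fin.forall_fin_two]
  exact ⟨fun x => congrArg Prod.fst (hh₂ x), fun x => congrArg (fun t => t.2.1) (hh₂ x),
    fun x => congrArg (fun t => t.2.2) (hh₂ x)⟩

/-- Face maps between resolutions that agree on `π_0` induce the same map on Baer invariants. -/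
theorem π₁_modV_eq (V : Set (FreeGroup ℕ)) (F E : FaceMap R.K S.K)
    (hFE : ∀ x, S.ε (F.h₀ x) = S.ε (E.h₀ x)) : (F.modV V).π₁ = (E.modV V).π₁ := by
  obtain ⟨h, hh⟩ := R.free.exists_lift 0 ((face S.K 0).prod (face S.K 1)) (F.h₀.prod E.h₀)
    fun x => by
      obtain ⟨y, h0, h1⟩ := exists_faces_one (S.ε_eq_iff.1 (hFE x))
      exact ⟨y, Prod.ext h0 h1⟩
  have hh0 : ∀ x, face S.K 0 (h x) = F.h₀ x := fun x => congrArg Prod.fst (hh x)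
  have hh1 : ∀ x, face S.K 1 (h x) = E.h₀ x := fun x => congrArg Prod.snd (hh x)
  obtain ⟨a, ha⟩ := R.free.exists_lift 1 ((face S.K 0).prod (face S.K 2))
    (F.h₁.prod (h.comp (face R.K 1))) fun x => by
      obtain ⟨y, h0, h2⟩ := exists_faces_zero_two (a := F.h₁ x) (c := h (face R.K 1 x))
        (by rw [F.face_h₁, hh0])
      exact ⟨y, Prod.ext h0 h2⟩
  have ha0 : ∀ x, face S.K 0 (a x) = F.h₁ x := fun x => congrArg Prod.fst (ha x)
  have ha2 : ∀ x, face S.K 2 (a x) = h (face R.K 1 x) := fun x => congrArg Prod.snd (ha x)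
  obtain ⟨b, hb⟩ := R.free.exists_lift 1 ((face S.K 0).prod ((face S.K 1).prod (face S.K 2)))
    ((h.comp (face R.K 0)).prod (((face S.K 1).comp a).prod E.h₁)) fun x => by
      obtain ⟨y, h0, h1, h2⟩ := exists_faces_two (S.trivial_of_pos 1 le_rfl)
        (a := h (face R.K 0 x)) (b := face S.K 1 (a x)) (c := E.h₁ x)
        (by rw [face_zero_face_one, ha0, F.face_h₁, hh0]) (by rw [E.face_h₁, hh1])
        (by rw [← face_one_face_two, ha2, E.face_h₁, hh1])
      exact ⟨y, Prod.ext h0 (Prod.ext h1 h2)⟩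
  exact FaceMap.π₁_modV_eq_of_homotopy V F E h a b ha0 ha2 (fun x => congrArg Prod.fst (hb x))
    (fun x => congrArg (fun t => t.2.1) (hb x)) (fun x => congrArg (fun t => t.2.2) (hb x))

/-- The Baer invariant does not depend on the resolution. -/
theorem nonempty_baer_mulEquiv (V : Set (FreeGroup ℕ)) (e : G ≃* G') :
    Nonempty (R.baer V ≃* S.baer V) := by
  obtain ⟨F, hF⟩ := exists_faceMap R S e.toMonoidHom
  obtain ⟨E, hE⟩ := exists_faceMap S R e.symm.toMonoidHom
  refine ⟨MonoidHom.toMulEquiv (F.modV V).π₁ (E.modV V).π₁ ?_ ?_⟩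
  · refine MonoidHom.ext fun p => ?_
    change (E.modV V).π₁ ((F.modV V).π₁ p) = p
    rw [← FaceMap.π₁_comp_modV, R.π₁_modV_eq R V (E.comp F) (FaceMap.id _), FaceMap.π₁_id_modV]
    intro x
    refine (hE _).trans ?_
    rw [hF]
    exact e.symm_apply_apply _
  · refine MonoidHom.ext fun p => ?_
    change (F.modV V).π₁ ((E.modV V).π₁ p) = p
    rw [← FaceMap.π₁_comp_modV, S.π₁_modV_eq S V (F.comp E) (FaceMap.id _), FaceMap.π₁_id_modV]
    intro x
    refine (hF _).trans ?_
    rw [hE]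
    exact e.apply_symm_apply _

end FreeResolution

/-! ### Resolutions of a split pair -/

namespace PairResolution

variable {G : Type u} [Group G] {N : Subgroup G} [N.Normal] (R : PairResolution G N)

theorem ε_α (x : lvl R.resG.K 0) :
    R.resQuot.ε (appHom R.α 0 x) = QuotientGroup.mk' N (R.resG.ε x) :=
  R.α_π₀ (QuotientGroup.mk ⟨x, trivial⟩)

/-- A cycle of `L_.` in positive degree is the image of a simplex all of whose faces are
trivial. -/
theorem exists_lift_cycle {n : ℕ} {c : lvl R.resQuot.K (n + 1)}
    (hc : c ∈ cycles R.resQuot.K (n + 1)) :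
    ∃ v : lvl R.resG.K (n + 1), (∀ i, face R.resG.K i v = 1) ∧ appHom R.α (n + 1) v = c := by
  obtain ⟨w, hw, rfl⟩ := mem_boundaries_of_subsingleton
    (R.resQuot.trivial_of_pos (n + 1) (Nat.le_add_left 1 n)) hc
  obtain ⟨v, hv, rfl⟩ := exists_mem_moore_lift R.α R.α_surjective hw
  refine ⟨face R.resG.K (Fin.last (n + 2)) v, fun i => ?_, (δ_app R.α _ v).symm⟩
  have h := face_face R.resG.K (Fin.le_last i) v
  rw [mem_moore_succ.1 hv i, map_one] at h
  exact h

/-- If the image of `y` has the same faces as `b`, then some simplex over `b` has the same faces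
as `y`. -/
theorem exists_lift_of_faces {n : ℕ} (y : lvl R.resG.K (n + 1)) (b : lvl R.resQuot.K (n + 1))
    (h : ∀ i, appHom R.α n (face R.resG.K i y) = face R.resQuot.K i b) :
    ∃ y', (∀ i, face R.resG.K i y' = face R.resG.K i y) ∧ appHom R.α (n + 1) y' = b := by
  obtain ⟨v, hv, hvb⟩ := R.exists_lift_cycle (c := (appHom R.α (n + 1) y)⁻¹ * b) <| by
    refine mem_cycles_succ.2 fun i => ?_
    rw [map_mul, map_inv, δ_app, h, inv_mul_cancel]
  exact ⟨y * v, fun i => by rw [map_mul, hv, mul_one],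
    by rw [map_mul, hvb, mul_inv_cancel_left]⟩

/-- For any `y` over `g`, `α y` and `b` differ by `d_1` of a Moore edge. Lifting that edge to `v`
and multiplying `y` by `d_1 v` corrects the image and leaves `ε y` unchanged. -/
theorem exists_lift_of_ε (b : lvl R.resQuot.K 0) (g : G)
    (h : R.resQuot.ε b = QuotientGroup.mk' N g) :
    ∃ y, appHom R.α 0 y = b ∧ R.resG.ε y = g := by
  obtain ⟨y, rfl⟩ := R.resG.ε_surjective g
  rw [← ε_α, eq_comm, FreeResolution.ε_eq_iff] at h
  obtain ⟨w, hw, hwb⟩ := h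
  obtain ⟨v, hv, rfl⟩ := exists_mem_moore_lift R.α R.α_surjective hw
  change face R.resQuot.K 1 (appHom R.α 1 v) = _ at hwb
  rw [δ_app] at hwb
  refine ⟨y * face R.resG.K 1 v, by rw [map_mul, hwb, mul_inv_cancel_left], ?_⟩
  rw [map_mul, ← FreeResolution.ε_face, mem_moore_one.1 hv, map_one, mul_one]

/-- A splitting of `G → G/N` lifts to a section of `α` in degrees at most two that is compatible
with the faces. -/
theorem exists_section (s : G ⧸ N →* G) (hs : ∀ q, QuotientGroup.mk' N (s q) = q) :
    ∃ F : FaceMap R.resQuot.K R.resG.K, (∀ x, appHom R.α 1 (F.h₁ x) = x) ∧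
      ∀ x, appHom R.α 2 (F.h₂ x) = x := by
  -- Prescribing `ε` through `s` is what later puts the two ends of each edge in the same component
  -- of `K`.
  obtain ⟨h₀, hh₀⟩ := R.resQuot.free.exists_lift 0 ((appHom R.α 0).prod R.resG.ε)
    ((MonoidHom.id _).prod (s.comp R.resQuot.ε)) fun x => by
      obtain ⟨y, h0, h1⟩ := R.exists_lift_of_ε x (s (R.resQuot.ε x)) (hs _).symm
      exact ⟨y, Prod.ext h0 h1⟩
  have hα₀ : ∀ x, appHom R.α 0 (h₀ x) = x := fun x => congrArg Prod.fst (hh₀ x)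
  have hε : ∀ x, R.resG.ε (h₀ x) = s (R.resQuot.ε x) := fun x => congrArg Prod.snd (hh₀ x)
  obtain ⟨h₁, hh₁⟩ := R.resQuot.free.exists_lift 1
    ((appHom R.α 1).prod ((face R.resG.K 0).prod (face R.resG.K 1)))
    ((MonoidHom.id _).prod ((h₀.comp (face R.resQuot.K 0)).prod
      (h₀.comp (face R.resQuot.K 1)))) fun x => by
      have h : R.resG.ε (h₀ (face R.resQuot.K 0 x)) = R.resG.ε (h₀ (face R.resQuot.K 1 x)) := by
        rw [hε, hε, FreeResolution.ε_face]
      obtain ⟨y, h0, h1⟩ := exists_faces_one (R.resG.ε_eq_iff.1 h)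
      obtain ⟨y', hy', hyx⟩ := R.exists_lift_of_faces y x <| by
        rw [Fin.forall_fin_two, h0, h1, hα₀, hα₀]
        exact ⟨rfl, rfl⟩
      exact ⟨y', Prod.ext hyx (Prod.ext ((hy' 0).trans h0) ((hy' 1).trans h1))⟩
  have hα₁ : ∀ x, appHom R.α 1 (h₁ x) = x := fun x => congrArg Prod.fst (hh₁ x)
  have hf₁ : ∀ i x, face R.resG.K i (h₁ x) = h₀ (face R.resQuot.K i x) :=
    Fin.forall_fin_two.2 ⟨fun x => congrArg (fun t => t.2.1) (hh₁ x),
      fun x => congrArg (fun t => t.2.2) (hh₁ x)⟩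
  obtain ⟨h₂, hh₂⟩ := R.resQuot.free.exists_lift 2
    ((appHom R.α 2).prod ((face R.resG.K 0).prod ((face R.resG.K 1).prod (face R.resG.K 2))))
    ((MonoidHom.id _).prod ((h₁.comp (face R.resQuot.K 0)).prod
      ((h₁.comp (face R.resQuot.K 1)).prod (h₁.comp (face R.resQuot.K 2))))) fun x => by
      obtain ⟨y, h0, h1, h2⟩ := exists_faces_two (R.resG.trivial_of_pos 1 le_rfl)
        -- The filler `y` has the right faces but need not lie over `x`; `exists_lift_of_faces`
        -- moves it there with its faces fixed.
        (a := h₁ (face R.resQuot.K 0 x)) (b := h₁ (face R.resQuot.K 1 x))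
        (c := h₁ (face R.resQuot.K 2 x))
        (by rw [hf₁, hf₁, face_zero_face_one]) (by rw [hf₁, hf₁, face_zero_face_two])
        (by rw [hf₁, hf₁, face_one_face_two])
      obtain ⟨y', hy', hyx⟩ := R.exists_lift_of_faces y x <| by
        rw [Fin.forall_fin_succ, Fin.forall_fin_two]
        exact ⟨(congrArg _ h0).trans (hα₁ _), (congrArg _ h1).trans (hα₁ _),
          (congrArg _ h2).trans (hα₁ _)⟩
      exact ⟨y', Prod.ext hyx (Prod.ext ((hy' 0).trans h0)
        (Prod.ext ((hy' 1).trans h1) ((hy' 2).trans h2)))⟩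
  refine ⟨⟨h₀, h₁, h₂, hf₁, ?_⟩, hα₁, fun x => congrArg Prod.fst (hh₂ x)⟩
  rw [Fin.forall_fin_succ, Fin.forall_fin_two]
  exact ⟨fun x => congrArg (fun t => t.2.1) (hh₂ x),
    fun x => congrArg (fun t => t.2.2.1) (hh₂ x), fun x => congrArg (fun t => t.2.2.2) (hh₂ x)⟩

/-- Gives both the surjectivity of `baerProj` and the splitting behind the direct product. -/
theorem homotopyMap_modV_π₁ (V : Set (FreeGroup ℕ)) (F : FaceMap R.resQuot.K R.resG.K)
    (hF : ∀ x, appHom R.α 1 (F.h₁ x) = x) (p : R.resQuot.baer V) :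
    R.baerProj V ((F.modV V).π₁ p) = p := by
  induction p using QuotientGroup.induction_on with | _ x
  obtain ⟨x, hx⟩ := x
  refine congrArg QuotientGroup.mk (Subtype.ext ?_)
  obtain ⟨y, rfl⟩ := toModV_surjective V _ 1 x
  exact congrArg (toModV V R.resQuot.K 1) (hF y)

/-- If `α` has a section compatible with the faces, it is surjective on `π_2` modulo verbal subgroups. -/
theorem surjective_homotopyMap_modV_two (V : Set (FreeGroup ℕ))
    (F : FaceMap R.resQuot.K R.resG.K) (hF : ∀ x, appHom R.α 2 (F.h₂ x) = x) :
    Function.Surjective (homotopyMap ((modV V).map R.α) 2) := by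
  refine surjective_homotopyMap_of_section _ (F.modV V).h₁ (F.modV V).h₂ (F.modV V).face_h₂
    fun x => ?_
  obtain ⟨y, rfl⟩ := toModV_surjective V _ 2 x
  exact congrArg (toModV V R.resQuot.K 2) (hF y)

end PairResolution

end PairBaer

/-- A split extension `1 → A → P → B → 1` with `P` commutative is a direct product. -/
theorem MonoidHom.nonempty_mulEquiv_prod_of_split {A P B : Type*} [Group A] [Group P] [Group B]
    (hP : ∀ x y : P, x * y = y * x) (i : A →* P) (p : P →* B) (s : B →* P)
    (hi : Function.Injective i) (hip : i.range = p.ker) (hs : ∀ b, p (s b) = b) :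
    Nonempty (P ≃* A × B) := by
  have hpi (a : A) : p (i a) = 1 := hip.le ⟨a, rfl⟩
  refine ⟨(MulEquiv.ofBijective (i.noncommCoprod s fun _ _ => hP _ _) ⟨?_, fun x => ?_⟩).symm⟩
  · rw [injective_iff_map_eq_one]
    rintro ⟨a, b⟩ h
    change i a * s b = 1 at h
    have hb : b = 1 := by simpa [hpi, hs] using congrArg p h
    subst hb
    rw [map_one, mul_one] at h
    exact Prod.ext ((injective_iff_map_eq_one i).1 hi a h) rfl
  · obtain ⟨a, ha⟩ : x * (s (p x))⁻¹ ∈ i.range := by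
      rw [hip, MonoidHom.mem_ker, map_mul, map_inv, hs, mul_inv_cancel]
    refine ⟨(a, p x), ?_⟩
    change i a * s (p x) = x
    rw [ha, inv_mul_cancel_right]

/-! ### The theorem for semidirect products. -/

theorem theorem3p3 (V : Set (FreeGroup ℕ)) {G : Type u} [Group G]
    (N Q : Subgroup G) [N.Normal] (hNQ : Subgroup.IsComplement' N Q)
    (R : PairBaer.PairResolution G N) (S : PairBaer.FreeResolution Q) :
    (Function.Surjective (R.baerProj V) ∧
      Function.Injective (R.baerIncl V) ∧
      (R.baerIncl V).range = (R.baerProj V).ker) ∧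
    Nonempty (R.resG.baer V ≃* R.baer V × S.baer V) := by
  let e : (G ⧸ N) ≃* Q := hNQ.symm.QuotientMulEquiv
  -- The splitting of `G → G/N` sends a coset to its unique representative in `Q`.
  obtain ⟨F, hF₁, hF₂⟩ := R.exists_section (Q.subtype.comp e.toMonoidHom) fun q =>
    Subgroup.IsComplement.quotientGroupMk_leftQuotientEquiv hNQ.symm q
  have hsec := R.homotopyMap_modV_π₁ V F hF₁
  have hα n : Function.Surjective (PairBaer.appHom ((PairBaer.modV V).map R.α) n) :=
    PairBaer.appHom_modV_surjective V (R.α_surjective n)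
  have hinj : Function.Injective (R.baerIncl V) :=
    PairBaer.injective_homotopyMap_kerSι _ hα (R.surjective_homotopyMap_modV_two V F hF₂)
  have hrange : (R.baerIncl V).range = (R.baerProj V).ker :=
    PairBaer.range_homotopyMap_kerSι _ hα 0
  refine ⟨⟨fun p => ⟨_, hsec p⟩, hinj, hrange⟩, ?_⟩
  obtain ⟨φ⟩ := R.resQuot.nonempty_baer_mulEquiv S V e
  obtain ⟨ψ⟩ := MonoidHom.nonempty_mulEquiv_prod_of_split PairBaer.homotopyGroup_one_mul_comm
    (R.baerIncl V) (R.baerProj V) (F.modV V).π₁ hinj hrange hsec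
  exact ⟨ψ.trans ((MulEquiv.refl _).prodCongr φ)⟩
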